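/- A Motzkin path of length $n$ is a lattice path from $(0,0)$ to $(n,0)$ with steps $U=(1,1)$, $D=(1,-1)$, $H=(1,0)$ that never goes below the $x$-axis. For $1\le i\le n-1$ let $s_i$ act on the right on a permutation $\pi=\pi_1\cdots\pi_n$ of $[n]$ by interchanging the entries in positions $i$ and $i+1$. A canonical reduced decomposition of $\pi$ is an expression $$\pi=(1\,2\,\cdots\,n)\,\sigma_1\sigma_2\cdots\sigma_k,\qquad \sigma_i=s_{h_i}s_{h_i-1}\cdots s_{t_i},\quad 1\le t_i\le h_i\ (1\le i\le k),\quad 1\le h_1<h_2<\cdots<h_k\le n-1,$$ where $(1\,2\,\cdots\,n)$ is the identity permutation in one-line notation. The map $\phi$ from Motzkin paths of length $n$ to permutations of $[n]$ is defined by the strip decomposition. Subdivide the region between the path and the $x$-axis into unit squares and triangles with unit bottom sides, and label a square, or a triangle containing a down step, with bottom side from $(x,y)$ to $(x+1,y)$ by $x+y$. Let $P$ have $k$ up steps. If $k\ge 1$, let $A\to B$ be its last up step and $E\to F$ its last down step. Let $h_k$ be the label of the cell containing $E\to F$, and let $t_k$ be the label of the cell containing the step that starts at $B$ (for a horizontal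 step, the unit square directly below it). Replace $P$ by the Motzkin path with $k-1$ up steps obtained by moving the points from $B$ to $E$ down by $1$, joining $A$ to the lowered $B$, and continuing from the lowered $E$ along the $x$-axis to $(n,0)$. Repeat with this path to obtain $(h_{k-1},t_{k-1}),\dots,(h_1,t_1)$. Put $\phi(P)=(1\,2\,\cdots\,n)\,\sigma_1\cdots\sigma_k$ with $\sigma_i=s_{h_i}s_{h_i-1}\cdots s_{t_i}$. If $k=0$, then $\phi(P)$ is the identity. **Statement.** Let $P$ be a Motzkin path of length $n$, and suppose that $\pi=\phi(P)$ has the canonical reduced decomposition $\sigma_1\cdots\sigma_k$ with heads $h_i$ and tails $t_i$ as above. Then: 1. if $k\ge1$, then $t_1-1$ is the number of initial horizontal steps of $P$ on the $x$-axis, i.e. the length of the maximal run of horizontal steps with which $P$ begins; 2. if $k\ge1$, then $n-1-h_k$ is the number of final horizontal steps of $P$ on the $x$-axis, i.e. the length of the maximal run of horizontal steps with which $P$ ends; 3. $\sum_i (t_{i+1}-h_i-2)$, summed over all $1\le i\le k-1$ with $h_i+1<t_{i+1}$, is the number of horizontal steps of $P$ on the $x$-axis that are neither initial nor final. -/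

import Mathlib

namespace Motzkin

/-- The steps `U = (1,1)`, `H = (1,0)` and `D = (1,-1)`. -/
inductive Step where
  | U : Step
  | H : Step
  | D : Step
  deriving DecidableEq

/-- The change of the `y`-coordinate along a step. -/
def Step.rise : Step → ℤ
  | .U => 1
  | .H => 0
  | .D => -1

/-- The `y`-coordinate of the point with `x`-coordinate `i` on the path that starts at `(0,0)` and
has the list of steps `w`.  The steps are numbered `0, 1, 2, …`, so this is the height of step `i`,
which goes from `x = i` to `x = i + 1`. -/
def height (w : List Step) (i : ℕ) : ℤ :=
  ((w.take i).map Step.rise).sum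

end Motzkin

/-- A Motzkin path of length `n`: a path from `(0,0)` to `(n,0)` with steps `U`, `H`, `D` that never
goes below the `x`-axis. -/
structure MotzkinPath (n : ℕ) where
  /-- the steps, from left to right -/
  steps : List Motzkin.Step
  length_eq : steps.length = n
  height_nonneg : ∀ i ≤ n, 0 ≤ Motzkin.height steps i
  height_end : Motzkin.height steps n = 0

namespace Motzkin

/-! ### Horizontal steps on the `x`-axis -/

/-- Step `i` exists, is horizontal and lies on the `x`-axis. -/
def IsAxisStep (w : List Step) (i : ℕ) : Prop :=
  w[i]? = some Step.H ∧ height w i = 0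

instance (w : List Step) (i : ℕ) : Decidable (IsAxisStep w i) :=
  inferInstanceAs (Decidable (_ ∧ _))

/-- Step `i` is one of the horizontal steps on the `x`-axis with which the path begins. -/
def IsInitialStep (w : List Step) (i : ℕ) : Prop :=
  ∀ j ≤ i, IsAxisStep w j

instance (w : List Step) (i : ℕ) : Decidable (IsInitialStep w i) :=
  inferInstanceAs (Decidable (∀ j ≤ i, IsAxisStep w j))

/-- Step `i` (with `i < w.length`) is one of the horizontal steps on the `x`-axis with which the
path ends. -/
def IsFinalStep (w : List Step) (i : ℕ) : Prop :=
  ∀ j < w.length, i ≤ j → IsAxisStep w j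

instance (w : List Step) (i : ℕ) : Decidable (IsFinalStep w i) :=
  inferInstanceAs (Decidable (∀ j < w.length, i ≤ j → IsAxisStep w j))

/-- The number of initial horizontal steps on the `x`-axis. -/
def numInitial (w : List Step) : ℕ :=
  ((Finset.range w.length).filter fun i => IsInitialStep w i).card

/-- The number of final horizontal steps on the `x`-axis. -/
def numFinal (w : List Step) : ℕ :=
  ((Finset.range w.length).filter fun i => IsFinalStep w i).card

/-- The number of horizontal steps on the `x`-axis that are neither initial nor final. -/
def numInner (w : List Step) : ℕ :=
  ((Finset.range w.length).filter fun i =>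
    IsAxisStep w i ∧ ¬ IsInitialStep w i ∧ ¬ IsFinalStep w i).card

/-! ### The strip decomposition -/

/-- The position of the last step of kind `s` (used only when there is one). -/
def lastIndex (s : Step) (w : List Step) : ℕ :=
  Nat.findGreatest (fun i => w[i]? = some s) w.length

/-- The `(x+y)`-label of the cell containing step `i`, when this step is horizontal or down and
starts at a point `(x, y)` with `x = i` and `y ≥ 1`.  The cell is the unit square below the step
(horizontal step) or the triangle below the step (down step).  In both cases its bottom side goes
from `(x, y - 1)` to `(x + 1, y - 1)`, so its label is `x + (y - 1)`. -/
def cellLabel (w : List Step) (i : ℕ) : ℕ :=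
  ((i : ℤ) + (height w i - 1)).toNat

/-- The head of the strip of `w`: the label of the cell containing the last down step `E → F`. -/
def stripHead (w : List Step) : ℕ :=
  cellLabel w (lastIndex Step.D w)

/-- The tail of the strip of `w`: the label of the cell containing the step that starts at the end
point `B` of the last up step `A → B`. -/
def stripTail (w : List Step) : ℕ :=
  cellLabel w (lastIndex Step.U w + 1)

/-- The path obtained by removing the strip.  The points of the path from `B` to `E` are moved one
layer lower; `A` is joined to the lowered `B`, and from the lowered `E` one continues along the
`x`-axis.  Thus the steps from `B` to `E` are unchanged, while the last up step `A → B` and the last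
down step `E → F` become horizontal (after `F` a Motzkin path runs along the `x`-axis anyway). -/
def removeStrip (w : List Step) : List Step :=
  (w.set (lastIndex Step.U w) Step.H).set (lastIndex Step.D w) Step.H

/-- The parameters `(h₁, t₁), …, (h_k, t_k)` from removing `k` strips one after another; the strip
removed first gives the last pair. -/
def stripsAux : ℕ → List Step → List (ℕ × ℕ)
  | 0, _ => []
  | k + 1, w => stripsAux k (removeStrip w) ++ [(stripHead w, stripTail w)]

/-- The parameters `(h₁, t₁), …, (h_k, t_k)` of the strip decomposition of a Motzkin path with `k`
up steps. -/
def strips (w : List Step) : List (ℕ × ℕ) :=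
  stripsAux (w.count Step.U) w

/-! ### Permutations and the map `φ` -/

/-- The simple transposition `s_i`, `1 ≤ i ≤ n - 1`, interchanging `i` and `i + 1` (and the identity
for other `i`).  The element `j : Fin n` stands for `j + 1 ∈ [n]`.  For a permutation
`π = π₁ π₂ ⋯ π_n`, the right action `π s_i`, which interchanges the entries in positions `i` and
`i + 1`, is the product `π * simpleTransposition n i`. -/
def simpleTransposition (n i : ℕ) : Equiv.Perm (Fin n) :=
  if hi : 1 ≤ i ∧ i < n then Equiv.swap ⟨i - 1, by omega⟩ ⟨i, hi.2⟩ else 1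

/-- `s_h s_{h-1} ⋯ s_t` for `h ≥ t`. -/
def descendingProduct (n h t : ℕ) : Equiv.Perm (Fin n) :=
  ((List.range (h + 1 - t)).map fun j => simpleTransposition n (h - j)).prod

/-- The permutation `(1 2 ⋯ n) σ₁ σ₂ ⋯ σ_k`, where `σ_i = s_{h_i} s_{h_i - 1} ⋯ s_{t_i}` and the
list consists of the pairs `(h_i, t_i)`. -/
def permOfPairs (n : ℕ) (l : List (ℕ × ℕ)) : Equiv.Perm (Fin n) :=
  (l.map fun p => descendingProduct n p.1 p.2).prod

/-- `(h_i, t_i)`, `1 ≤ i ≤ k`, are the heads and tails of the canonical reduced decomposition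
`π = (1 2 ⋯ n) σ₁ σ₂ ⋯ σ_k`, where `σ_i = s_{h_i} s_{h_i - 1} ⋯ s_{t_i}`.  The values of `h` and `t`
outside `1, …, k` are irrelevant. -/
structure IsCanonicalDecomposition (n : ℕ) (π : Equiv.Perm (Fin n)) (k : ℕ) (h t : ℕ → ℕ) :
    Prop where
  one_le_tail : ∀ i, 1 ≤ i → i ≤ k → 1 ≤ t i
  tail_le_head : ∀ i, 1 ≤ i → i ≤ k → t i ≤ h i
  head_lt : ∀ i, 1 ≤ i → i ≤ k → h i < n
  head_lt_head : ∀ i, 1 ≤ i → i < k → h i < h (i + 1)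
  eq_prod : π = permOfPairs n ((List.range k).map fun i => (h (i + 1), t (i + 1)))

end Motzkin

/-- The map `φ` from Motzkin paths of length `n` to permutations of `[n]`. -/
def MotzkinPath.phi {n : ℕ} (P : MotzkinPath n) : Equiv.Perm (Fin n) :=
  Motzkin.permOfPairs n (Motzkin.strips P.steps)

namespace Motzkin

/-! ### Uniqueness of canonical reduced decompositions -/

/-! A canonical decomposition is determined by its permutation: the earlier factors have smaller
heads, so `h_k` is the largest moved index of `Fin n` and `t_k - 1` is its preimage; cancelling
`σ_k` gives an induction (`IsCanonicalList.eq_of_permOfPairs_eq`). The strips form a canonical list,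
so the given heads and tails are those of the strips.

The counts follow by induction on the number of strips. Let `a` and `e` be the last up and down
steps. Then `h_k = e` and `t_k = a + 1 + height w a`. After `e` the path runs on the axis, which
counts the final steps. Removing the strip changes nothing before `a`; let `e'` be the last down
step of the new path, so `h_{k-1} = e'`. If `a` starts on the axis, then `e' < a`, and the steps
strictly between them are the new inner ones, `a - e' - 1 = t_k - h_{k-1} - 2` in number. Otherwise
`t_k ≤ h_{k-1} + 1`: the sum has no new term, and no inner step is gained. With a single strip, all
steps before `a` are initial and `t_1 = a + 1`. -/

theorem simpleTransposition_of_lt {n i : ℕ} {x : Fin n} (hx : i < x) :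
    simpleTransposition n i x = x := by
  unfold simpleTransposition
  split_ifs with hi
  · apply Equiv.swap_apply_of_ne_of_ne <;> (rw [Ne, Fin.ext_iff]; simp only; omega)
  · rfl

theorem simpleTransposition_pred {n i : ℕ} (h1 : 1 ≤ i) (h2 : i < n) :
    simpleTransposition n i ⟨i - 1, by omega⟩ = ⟨i, h2⟩ := by
  unfold simpleTransposition
  rw [dif_pos ⟨h1, h2⟩, Equiv.swap_apply_left]

theorem prod_apply_eq_self {α : Type*} {x : α} (l : List (Equiv.Perm α))
    (hl : ∀ σ ∈ l, σ x = x) : l.prod x = x := by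
  induction l with
  | nil => rfl
  | cons σ l ih =>
    rw [List.prod_cons, Equiv.Perm.mul_apply, ih fun τ hτ => hl τ (List.mem_cons_of_mem _ hτ)]
    exact hl σ List.mem_cons_self

theorem descendingProduct_of_lt {n h t : ℕ} {x : Fin n} (hx : h < x) :
    descendingProduct n h t x = x := by
  apply prod_apply_eq_self
  intro σ hσ
  obtain ⟨j, -, rfl⟩ := List.mem_map.1 hσ
  exact simpleTransposition_of_lt (by omega)

theorem descendingProduct_succ {n h t : ℕ} (hth : t ≤ h + 1) :
    descendingProduct n (h + 1) t = simpleTransposition n (h + 1) * descendingProduct n h t := by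
  unfold descendingProduct
  rw [show h + 1 + 1 - t = (h + 1 - t) + 1 by omega, List.range_succ_eq_map, List.map_cons,
    List.prod_cons, List.map_map]
  congr 3
  funext j
  simp only [Function.comp, Nat.succ_eq_add_one, Nat.add_sub_add_right]

/-- The rightmost factor `s_t` acts first, and each later factor raises the image by one. The index
`t - 1` of `Fin n` stands for position `t`. -/
theorem descendingProduct_tail {n h t : ℕ} (ht : 1 ≤ t) (hth : t ≤ h) (hn : h < n) :
    descendingProduct n h t ⟨t - 1, by omega⟩ = ⟨h, hn⟩ := by
  induction h, hth using Nat.le_induction with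
  | base =>
    have : t + 1 - t = 1 := by omega
    simp [descendingProduct, this, simpleTransposition_pred ht hn]
  | succ h hth ih =>
    rw [descendingProduct_succ (by omega), Equiv.Perm.mul_apply, ih (by omega)]
    exact simpleTransposition_pred (i := h + 1) (by omega) hn

/-- The conditions on the heads and tails of a canonical reduced decomposition. -/
structure IsCanonicalList (n : ℕ) (l : List (ℕ × ℕ)) : Prop where
  bounds : ∀ p ∈ l, 1 ≤ p.2 ∧ p.2 ≤ p.1 ∧ p.1 < n
  heads : l.Pairwise fun p q => p.1 < q.1

theorem permOfPairs_of_lt {n : ℕ} {l : List (ℕ × ℕ)} {x : Fin n} (hl : ∀ p ∈ l, p.1 < x) :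
    permOfPairs n l x = x := by
  apply prod_apply_eq_self
  intro σ hσ
  obtain ⟨p, hp, rfl⟩ := List.mem_map.1 hσ
  exact descendingProduct_of_lt (hl p hp)

theorem permOfPairs_append_singleton (n : ℕ) (l : List (ℕ × ℕ)) (p : ℕ × ℕ) :
    permOfPairs n (l ++ [p]) = permOfPairs n l * descendingProduct n p.1 p.2 := by
  simp [permOfPairs]

theorem isCanonicalList_append_singleton {n : ℕ} {l : List (ℕ × ℕ)} {p : ℕ × ℕ} :
    IsCanonicalList n (l ++ [p]) ↔
      IsCanonicalList n l ∧ (1 ≤ p.2 ∧ p.2 ≤ p.1 ∧ p.1 < n) ∧ ∀ q ∈ l, q.1 < p.1 := by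
  constructor
  · rintro ⟨hb, hh⟩
    rw [List.pairwise_append] at hh
    exact ⟨⟨fun q hq => hb q (by simp [hq]), hh.1⟩, hb p (by simp),
      fun q hq => hh.2.2 q hq p (by simp)⟩
  · rintro ⟨⟨hb, hh⟩, hp, hl⟩
    refine ⟨?_, List.pairwise_append.2 ⟨hh, by simp, by simpa using hl⟩⟩
    intro q hq
    rcases List.mem_append.1 hq with hq | hq
    · exact hb q hq
    · rw [List.mem_singleton.1 hq]; exact hp

theorem IsCanonicalList.permOfPairs_tail {n : ℕ} {l : List (ℕ × ℕ)} {h t : ℕ}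
    (hl : IsCanonicalList n (l ++ [(h, t)])) (ht : t - 1 < n) (hn : h < n) :
    permOfPairs n (l ++ [(h, t)]) ⟨t - 1, ht⟩ = ⟨h, hn⟩ := by
  obtain ⟨-, ⟨h1, h2, h3⟩, h4⟩ := isCanonicalList_append_singleton.1 hl
  rw [permOfPairs_append_singleton, Equiv.Perm.mul_apply, descendingProduct_tail h1 h2 h3]
  exact permOfPairs_of_lt h4

/-- The last head is at most any bound beyond which the permutation is the identity. -/
theorem IsCanonicalList.last_head_le {n : ℕ} {l : List (ℕ × ℕ)} {h t m : ℕ}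
    (hl : IsCanonicalList n (l ++ [(h, t)]))
    (hm : ∀ x : Fin n, m < x → permOfPairs n (l ++ [(h, t)]) x = x) : h ≤ m := by
  obtain ⟨-, ⟨h1, h2, h3⟩, -⟩ := isCanonicalList_append_singleton.1 hl
  simp only at h1 h2 h3
  by_contra hlt
  -- If `h` were fixed, both `t - 1` and `h` would map to `h`, against `t ≤ h`.
  have e1 := hl.permOfPairs_tail (by omega) h3
  have e2 := hm ⟨h, h3⟩ (by simpa using hlt)
  have := congrArg Fin.val ((permOfPairs n (l ++ [(h, t)])).injective (e1.trans e2.symm))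
  simp only at this
  omega

theorem IsCanonicalList.permOfPairs_of_lt_last {n : ℕ} {l : List (ℕ × ℕ)} {h t : ℕ}
    (hl : IsCanonicalList n (l ++ [(h, t)])) (x : Fin n) (hx : h < x) :
    permOfPairs n (l ++ [(h, t)]) x = x := by
  obtain ⟨-, -, h4⟩ := isCanonicalList_append_singleton.1 hl
  apply permOfPairs_of_lt
  intro q hq
  rcases List.mem_append.1 hq with hq | hq
  · exact (h4 q hq).trans hx
  · rw [List.mem_singleton.1 hq]; exact hx

theorem IsCanonicalList.permOfPairs_append_ne_one {n : ℕ} {l : List (ℕ × ℕ)} {p : ℕ × ℕ}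
    (hl : IsCanonicalList n (l ++ [p])) : permOfPairs n (l ++ [p]) ≠ 1 := by
  intro h1
  obtain ⟨-, ⟨h2, h3, -⟩, -⟩ := isCanonicalList_append_singleton.1 hl
  have := IsCanonicalList.last_head_le (l := l) (h := p.1) (t := p.2) (m := 0) hl
    (fun x _ => by rw [show l ++ [(p.1, p.2)] = l ++ [p] from rfl, h1]; rfl)
  omega

theorem IsCanonicalList.eq_of_permOfPairs_eq {n : ℕ} {l l' : List (ℕ × ℕ)}
    (hl : IsCanonicalList n l) (hl' : IsCanonicalList n l')
    (h : permOfPairs n l = permOfPairs n l') : l = l' := by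
  induction l using List.reverseRecOn generalizing l' with
  | nil =>
    rcases List.eq_nil_or_concat' l' with rfl | ⟨m', q, rfl⟩
    · rfl
    · exact absurd h.symm hl'.permOfPairs_append_ne_one
  | append_singleton m p ih =>
    rcases List.eq_nil_or_concat' l' with rfl | ⟨m', q, rfl⟩
    · exact absurd h hl.permOfPairs_append_ne_one
    · obtain ⟨a, b⟩ := p
      obtain ⟨a', b'⟩ := q
      -- Each head is a bound beyond which the common permutation is the identity.
      have haa : a = a' := le_antisymm
        (hl.last_head_le fun x hx => by rw [h]; exact hl'.permOfPairs_of_lt_last x hx)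
        (hl'.last_head_le fun x hx => by rw [← h]; exact hl.permOfPairs_of_lt_last x hx)
      subst haa
      obtain ⟨c1, ⟨h1, h2, h3⟩, -⟩ := isCanonicalList_append_singleton.1 hl
      obtain ⟨c2, ⟨h4, h5, -⟩, -⟩ := isCanonicalList_append_singleton.1 hl'
      simp only at h1 h2 h3 h4 h5
      have e1 := hl.permOfPairs_tail (by omega) h3
      have e2 := hl'.permOfPairs_tail (by omega) h3
      rw [← h] at e2
      have := congrArg Fin.val ((permOfPairs n (m ++ [(a, b)])).injective (e1.trans e2.symm))
      simp only at this
      have hbb : b = b' := by omega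
      subst hbb
      rw [permOfPairs_append_singleton, permOfPairs_append_singleton] at h
      rw [ih c1 c2 (mul_right_cancel h)]

theorem IsCanonicalDecomposition.isCanonicalList {n : ℕ} {π : Equiv.Perm (Fin n)} {k : ℕ}
    {h t : ℕ → ℕ} (hd : IsCanonicalDecomposition n π k h t) :
    IsCanonicalList n ((List.range k).map fun i => (h (i + 1), t (i + 1))) := by
  have hmono : ∀ i j, i < j → j < k → h (i + 1) < h (j + 1) := by
    intro i j hij
    induction j, hij using Nat.le_induction with
    | base => intro hj; exact hd.head_lt_head _ (by omega) (by omega)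
    | succ j _ ih =>
      intro hj
      exact (ih (by omega)).trans (hd.head_lt_head _ (by omega) (by omega))
  constructor
  · intro p hp
    obtain ⟨i, hi, rfl⟩ := List.mem_map.1 hp
    rw [List.mem_range] at hi
    exact ⟨hd.one_le_tail _ (by omega) (by omega), hd.tail_le_head _ (by omega) (by omega),
      hd.head_lt _ (by omega) (by omega)⟩
  · rw [List.pairwise_map]
    refine List.Pairwise.imp_of_mem ?_ List.pairwise_lt_range
    intro i j _ hj hij
    exact hmono i j hij (List.mem_range.1 hj)

/-! ### Heights -/

theorem height_succ (w : List Step) (i : ℕ) :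
    height w (i + 1) = height w i + (w[i]?).elim 0 Step.rise := by
  unfold height
  rw [List.take_add_one]
  cases w[i]? <;> simp

theorem height_succ_of_eq {w : List Step} {i : ℕ} {s : Step} (hs : w[i]? = some s) :
    height w (i + 1) = height w i + s.rise := by
  rw [height_succ, hs]; rfl

theorem height_succ_bounds (w : List Step) (i : ℕ) :
    height w i - 1 ≤ height w (i + 1) ∧ (w[i]? ≠ some Step.U → height w (i + 1) ≤ height w i) ∧
      (w[i]? ≠ some Step.D → height w i ≤ height w (i + 1)) := by
  rw [height_succ]
  rcases w[i]? with _ | s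
  · simp
  · cases s <;> (simp [Step.rise]; try omega)

/-- Each step descends by at most one. This gives the lower bounds on horizontal distance needed to
compare tails with heads. -/
theorem height_sub_le (w : List Step) {i m : ℕ} (him : i ≤ m) :
    height w i - ((m : ℤ) - i) ≤ height w m := by
  induction m, him using Nat.le_induction with
  | base => simp
  | succ m _ ih =>
    have := (height_succ_bounds w m).1
    push_cast
    omega

theorem height_le_of_no_up {w : List Step} {i m : ℕ} (him : i ≤ m)
    (hw : ∀ j, i ≤ j → j < m → w[j]? ≠ some Step.U) : height w m ≤ height w i := by
  induction m, him using Nat.le_induction with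
  | base => exact le_rfl
  | succ m hm ih =>
    have := (height_succ_bounds w m).2.1 (hw m hm (by omega))
    have := ih fun j h1 h2 => hw j h1 (by omega)
    omega

theorem height_le_of_no_down {w : List Step} {i m : ℕ} (him : i ≤ m)
    (hw : ∀ j, i ≤ j → j < m → w[j]? ≠ some Step.D) : height w i ≤ height w m := by
  induction m, him using Nat.le_induction with
  | base => exact le_rfl
  | succ m hm ih =>
    have := (height_succ_bounds w m).2.2 (hw m hm (by omega))
    have := ih fun j h1 h2 => hw j h1 (by omega)
    omega

/-- The list of steps of a Motzkin path. -/
structure IsMotzkin (w : List Step) : Prop where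
  nonneg : ∀ i ≤ w.length, 0 ≤ height w i
  height_end : height w w.length = 0

/-! ### The last up step and the last down step -/

theorem lastIndex_spec {s : Step} {w : List Step} {i : ℕ} (hi : w[i]? = some s) :
    w[lastIndex s w]? = some s ∧ i ≤ lastIndex s w := by
  obtain ⟨hlt, -⟩ := List.getElem?_eq_some_iff.1 hi
  exact ⟨Nat.findGreatest_spec (P := fun i => w[i]? = some s) hlt.le hi,
    Nat.le_findGreatest hlt.le hi⟩

theorem lt_length_of_getElem? {s : Step} {w : List Step} {i : ℕ} (hi : w[i]? = some s) :
    i < w.length :=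
  (List.getElem?_eq_some_iff.1 hi).1

theorem eq_H_of_ne {w : List Step} {i : ℕ} (hi : i < w.length) (hU : w[i]? ≠ some Step.U)
    (hD : w[i]? ≠ some Step.D) : w[i]? = some Step.H := by
  rw [List.getElem?_eq_getElem hi] at *
  cases h : w[i] <;> simp_all

theorem IsMotzkin.isAxisStep_of_no_up {w : List Step} (hw : IsMotzkin w)
    (hU : w.count Step.U = 0) {i : ℕ} (hi : i < w.length) : IsAxisStep w i := by
  have hne : ∀ j, w[j]? ≠ some Step.U := fun j hj =>
    List.count_eq_zero.1 hU (List.mem_of_getElem? hj)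
  have hz : ∀ j ≤ w.length, height w j = 0 := fun j hj =>
    le_antisymm (height_le_of_no_up (Nat.zero_le j) fun j _ _ => hne j) (hw.nonneg j hj)
  refine ⟨eq_H_of_ne hi (hne i) fun hD => ?_, hz i hi.le⟩
  have := height_succ_of_eq hD
  rw [hz i hi.le, hz (i + 1) hi] at this
  simp [Step.rise] at this

/-- The last up step `a` and the last down step `e` of a Motzkin path that has up steps. -/
structure IsLastStrip (w : List Step) (a e : ℕ) : Prop where
  lastIndex_U : lastIndex Step.U w = a
  lastIndex_D : lastIndex Step.D w = e
  up : w[a]? = some Step.U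
  down : w[e]? = some Step.D
  no_up : ∀ j, a < j → w[j]? ≠ some Step.U
  no_down : ∀ j, e < j → w[j]? ≠ some Step.D
  lt : a < e
  lt_length : e < w.length
  height_down : height w e = 1
  height_start_nonneg : 0 ≤ height w a

theorem IsMotzkin.exists_isLastStrip {w : List Step} (hw : IsMotzkin w)
    (hU : 0 < w.count Step.U) : ∃ a e, IsLastStrip w a e := by
  obtain ⟨i, hi⟩ := List.mem_iff_getElem?.1 (List.count_pos_iff.1 hU)
  have hup := (lastIndex_spec hi).1
  have hnoup : ∀ j, lastIndex Step.U w < j → w[j]? ≠ some Step.U := fun j hj h =>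
    absurd (lastIndex_spec h).2 (by omega)
  have hlen := lt_length_of_getElem? hup
  have h1 := height_succ_of_eq hup
  have h0 := hw.nonneg _ hlen.le
  simp only [Step.rise] at h1
  -- The end of the last up step has height at least 1, so the path must still descend to the axis.
  obtain ⟨d, hd1, hd2⟩ : ∃ d, lastIndex Step.U w < d ∧ w[d]? = some Step.D := by
    by_contra hno
    push Not at hno
    have := height_le_of_no_down (w := w) (i := lastIndex Step.U w + 1) (m := w.length) hlen
      fun j hj _ => hno j hj
    rw [hw.height_end] at this
    omega
  obtain ⟨hdown, hde⟩ := lastIndex_spec hd2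
  have hnodown : ∀ j, lastIndex Step.D w < j → w[j]? ≠ some Step.D := fun j hj h =>
    absurd (lastIndex_spec h).2 (by omega)
  have hlen' := lt_length_of_getElem? hdown
  refine ⟨_, _, rfl, rfl, hup, hdown, hnoup, hnodown, by omega, hlen', ?_, h0⟩
  -- After the last down step the height cannot decrease, and it ends at 0; hence it is already 0
  -- there.
  have e1 := height_succ_of_eq hdown
  have e2 := height_le_of_no_down (w := w) (i := lastIndex Step.D w + 1) (m := w.length) hlen'
      fun j hj _ => hnodown j hj
  have e3 := hw.nonneg (lastIndex Step.D w + 1) hlen'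
  rw [hw.height_end] at e2
  simp only [Step.rise] at e1
  omega

namespace IsLastStrip

variable {w : List Step} {a e : ℕ}

theorem one_le_height (s : IsLastStrip w a e) {i : ℕ} (h1 : a < i) (h2 : i ≤ e) :
    1 ≤ height w i := by
  rw [← s.height_down]
  exact height_le_of_no_up h2 fun j hj _ => s.no_up j (by omega)

theorem height_of_down_lt (s : IsLastStrip w a e) {i : ℕ} (h : e < i) : height w i = 0 := by
  have h1 := height_succ_of_eq s.down
  rw [s.height_down] at h1
  have h2 := height_le_of_no_up (w := w) (i := e + 1) (m := i) h fun j hj _ =>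
    s.no_up j (by have := s.lt; omega)
  have h3 := height_le_of_no_down (w := w) (i := e + 1) (m := i) h fun j hj _ => s.no_down j hj
  simp only [Step.rise] at h1
  omega

theorem isAxisStep_of_down_lt (s : IsLastStrip w a e) {i : ℕ} (h : e < i) (hi : i < w.length) :
    IsAxisStep w i :=
  ⟨eq_H_of_ne hi (s.no_up i (s.lt.trans h)) (s.no_down i h), s.height_of_down_lt h⟩

theorem not_isAxisStep (s : IsLastStrip w a e) {i : ℕ} (h1 : a ≤ i) (h2 : i ≤ e) :
    ¬ IsAxisStep w i := by
  rintro ⟨hH, h0⟩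
  rcases h1.eq_or_lt with rfl | h1
  · rw [s.up] at hH; cases hH
  · have := s.one_le_height h1 h2
    omega

theorem isFinalStep_iff (s : IsLastStrip w a e) {i : ℕ} :
    IsFinalStep w i ↔ e < i := by
  constructor
  · intro h
    by_contra hi
    exact s.not_isAxisStep s.lt.le le_rfl (h e s.lt_length (by omega))
  · intro h j hj hij
    exact s.isAxisStep_of_down_lt (by omega) hj

theorem lt_of_isInitialStep (s : IsLastStrip w a e) {i : ℕ} (h : IsInitialStep w i) : i < a := by
  by_contra hi
  exact s.not_isAxisStep le_rfl s.lt.le (h a (by omega))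

theorem numFinal_eq (s : IsLastStrip w a e) : numFinal w = w.length - 1 - e := by
  unfold numFinal
  rw [show (Finset.range w.length).filter (fun i => IsFinalStep w i)
    = Finset.Ioo e w.length by ext i; simp [s.isFinalStep_iff, and_comm]]
  simp
  omega

theorem stripHead_eq (s : IsLastStrip w a e) : stripHead w = e := by
  unfold stripHead cellLabel
  rw [s.lastIndex_D, s.height_down]
  simp

theorem stripTail_eq (s : IsLastStrip w a e) : (stripTail w : ℤ) = a + 1 + height w a := by
  unfold stripTail cellLabel
  have := height_succ_of_eq s.up
  have := s.height_start_nonneg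
  simp only [Step.rise] at *
  rw [s.lastIndex_U, Int.toNat_of_nonneg] <;> push_cast <;> omega

/-- Descending from height `height w a + 1` at `a + 1` to height 1 at `e` takes at least `height w
a` steps. -/
theorem stripTail_le_stripHead (s : IsLastStrip w a e) : stripTail w ≤ stripHead w := by
  have h1 := s.stripTail_eq
  have h2 := height_sub_le w (i := a + 1) (m := e) s.lt
  have h3 := height_succ_of_eq s.up
  rw [s.height_down] at h2
  simp only [Step.rise] at h3
  rw [s.stripHead_eq]
  push_cast at h2
  omega

/-! ### The path after removal of its last strip -/

theorem getElem?_removeStrip (s : IsLastStrip w a e) (i : ℕ) :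
    (removeStrip w)[i]? = if i = a ∨ i = e then some Step.H else w[i]? := by
  have h1 := s.lt
  have h2 := s.lt_length
  unfold removeStrip
  rw [s.lastIndex_U, s.lastIndex_D, List.getElem?_set, List.getElem?_set]
  simp only [List.length_set]
  grind

theorem height_removeStrip (s : IsLastStrip w a e) (i : ℕ) :
    height (removeStrip w) i
      = height w i + (if a < i then -1 else 0) + (if e < i then 1 else 0) := by
  have h1 := s.lt
  induction i with
  | zero => simp [height]
  | succ i ih =>
    rw [height_succ, height_succ, ih, s.getElem?_removeStrip]
    by_cases hia : i = a
    · subst hia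
      have : ¬ e < i := by omega
      have : ¬ e < i + 1 := by omega
      simp [*, s.up, Step.rise]
    · by_cases hie : i = e
      · subst hie
        have : a < i + 1 := by omega
        simp [*, s.down, Step.rise]
      · have e1 : a < i + 1 ↔ a < i := by omega
        have e2 : e < i + 1 ↔ e < i := by omega
        simp only [hia, hie, e1, e2, or_self, if_false]
        ring

theorem isAxisStep_removeStrip (s : IsLastStrip w a e) {i : ℕ} (h : i < a) :
    IsAxisStep (removeStrip w) i ↔ IsAxisStep w i := by
  have h1 := s.lt
  unfold IsAxisStep
  rw [s.getElem?_removeStrip, s.height_removeStrip, if_neg (by omega), if_neg (by omega),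
    if_neg (by omega)]
  simp

theorem isInitialStep_removeStrip (s : IsLastStrip w a e) {i : ℕ} (h : i < a) :
    IsInitialStep (removeStrip w) i ↔ IsInitialStep w i :=
  forall₂_congr fun j hj => s.isAxisStep_removeStrip (by omega)

theorem length_removeStrip (w : List Step) : (removeStrip w).length = w.length := by
  simp [removeStrip]

/-- Only the points `a < i ≤ e` are lowered, and these had height at least 1. -/
theorem isMotzkin_removeStrip (s : IsLastStrip w a e) (hw : IsMotzkin w) :
    IsMotzkin (removeStrip w) := by
  have h1 := s.lt
  have h2 := s.lt_length
  constructor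
  · intro i hi
    rw [length_removeStrip] at hi
    have h3 := hw.nonneg i hi
    rw [s.height_removeStrip]
    by_cases hai : a < i
    · by_cases hei : e < i
      · simp [hai, hei, h3]
      · have := s.one_le_height hai (by omega)
        simp [hai, hei, this]
    · have : ¬ e < i := by omega
      simp [hai, this, h3]
  · rw [length_removeStrip, s.height_removeStrip, hw.height_end, if_pos (by omega),
      if_pos (by omega)]
    rfl

theorem count_removeStrip (s : IsLastStrip w a e) :
    (removeStrip w).count Step.U + 1 = w.count Step.U := by
  have h1 := s.lt
  have h2 := s.lt_length
  have ha : w[a]'(h1.trans h2) = Step.U := by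
    have := s.up
    rwa [List.getElem?_eq_getElem (h1.trans h2), Option.some_inj] at this
  have he : w[e] = Step.D := by
    have := s.down
    rwa [List.getElem?_eq_getElem h2, Option.some_inj] at this
  have hpos : 0 < w.count Step.U :=
    List.count_pos_iff.2 (List.mem_of_getElem? s.up)
  unfold removeStrip
  rw [s.lastIndex_U, s.lastIndex_D, List.count_set (by simpa using h2),
    List.count_set (h1.trans h2), List.getElem_set_ne (by omega), ha, he]
  simp
  omega

theorem removeStrip_lt (s : IsLastStrip w a e) {a' e' : ℕ}
    (s' : IsLastStrip (removeStrip w) a' e') : a' < a ∧ e' < e := by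
  have hu := s'.up
  have hd := s'.down
  rw [s.getElem?_removeStrip] at hu hd
  split_ifs at hu with h1
  · cases hu
  split_ifs at hd with h2
  · cases hd
  have h3 : ¬ a < a' := fun h => s.no_up _ h hu
  have h4 : ¬ e < e' := fun h => s.no_down _ h hd
  omega

theorem removeStrip_down_ne (s : IsLastStrip w a e) {a' e' : ℕ}
    (s' : IsLastStrip (removeStrip w) a' e') : e' ≠ a := by
  rintro rfl
  have hd := s'.down
  rw [s.getElem?_removeStrip] at hd
  simp at hd

theorem height_removeStrip_up (s : IsLastStrip w a e) : height (removeStrip w) a = height w a := by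
  have := s.lt
  rw [s.height_removeStrip, if_neg (by omega), if_neg (by omega)]
  simp

/-- The new last down step precedes the last up step exactly if the latter starts on the axis. -/
theorem removeStrip_down_lt_iff (s : IsLastStrip w a e) {a' e' : ℕ}
    (s' : IsLastStrip (removeStrip w) a' e') : e' < a ↔ height w a = 0 := by
  rw [← s.height_removeStrip_up]
  constructor
  · exact s'.height_of_down_lt
  · intro h
    by_contra hlt
    have := s'.one_le_height (s.removeStrip_lt s').1 (by omega)
    omega

/-- The lowered point at `a + 1` has height `height w a`, and the new path must descend from there
to height 1 at `e'`. This yields `t_k ≤ h_{k-1} + 1`. -/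
theorem add_height_le_removeStrip_down (s : IsLastStrip w a e) {a' e' : ℕ}
    (s' : IsLastStrip (removeStrip w) a' e') (h : height w a ≠ 0) :
    (a : ℤ) + height w a ≤ e' := by
  have h1 : ¬ e' < a := fun h' => h ((s.removeStrip_down_lt_iff s').1 h')
  have h2 := s.removeStrip_down_ne s'
  have h3 := height_sub_le (removeStrip w) (i := a + 1) (m := e') (by omega)
  have h4 := height_succ_of_eq s.up
  have h5 := s.lt
  rw [s'.height_down, s.height_removeStrip, if_pos (by omega), if_neg (by omega), h4] at h3
  simp only [Step.rise] at h3
  push_cast at h3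
  omega

/-! ### Statistics of horizontal steps under the removal of a strip -/

theorem numInitial_removeStrip (s : IsLastStrip w a e) {a' e' : ℕ}
    (s' : IsLastStrip (removeStrip w) a' e') : numInitial (removeStrip w) = numInitial w := by
  unfold numInitial
  rw [length_removeStrip]
  congr 1
  refine Finset.filter_congr fun i _ => ⟨fun h => ?_, fun h => ?_⟩
  · exact (s.isInitialStep_removeStrip
      ((s'.lt_of_isInitialStep h).trans (s.removeStrip_lt s').1)).1 h
  · exact (s.isInitialStep_removeStrip (s.lt_of_isInitialStep h)).2 h

/-- A step before the last up step of a path that has a single up step is initial. -/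
theorem isInitialStep_of_count_eq_one (s : IsLastStrip w a e) (hw : IsMotzkin w)
    (hc : (removeStrip w).count Step.U = 0) {i : ℕ} (h : i < a) : IsInitialStep w i := by
  rw [← s.isInitialStep_removeStrip h]
  intro j hj
  refine (s.isMotzkin_removeStrip hw).isAxisStep_of_no_up hc ?_
  have := s.lt
  have := s.lt_length
  rw [length_removeStrip]
  omega

theorem numInitial_of_count_eq_one (s : IsLastStrip w a e) (hw : IsMotzkin w)
    (hc : (removeStrip w).count Step.U = 0) : numInitial w = a ∧ height w a = 0 := by
  have h1 := s.lt
  have h2 := s.lt_length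
  constructor
  · unfold numInitial
    rw [show (Finset.range w.length).filter (fun i => IsInitialStep w i) = Finset.range a by
      ext i
      simp only [Finset.mem_filter, Finset.mem_range]
      exact ⟨fun h => s.lt_of_isInitialStep h.2,
        fun h => ⟨by omega, s.isInitialStep_of_count_eq_one hw hc h⟩⟩]
    simp
  · rw [← s.height_removeStrip_up]
    exact ((s.isMotzkin_removeStrip hw).isAxisStep_of_no_up hc
      (by rw [length_removeStrip]; omega)).2

/-- Steps from `a` to `e` are off the axis, and all later ones are final. -/
theorem isInner_iff (s : IsLastStrip w a e) {i : ℕ} :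
    (IsAxisStep w i ∧ ¬ IsInitialStep w i ∧ ¬ IsFinalStep w i) ↔
      i < a ∧ IsAxisStep w i ∧ ¬ IsInitialStep w i := by
  rw [s.isFinalStep_iff]
  constructor
  · rintro ⟨h1, h2, h3⟩
    refine ⟨?_, h1, h2⟩
    by_contra h
    exact s.not_isAxisStep (by omega) (by omega) h1
  · rintro ⟨h1, h2, h3⟩
    have := s.lt
    exact ⟨h2, h3, by omega⟩

theorem numInner_of_count_eq_one (s : IsLastStrip w a e) (hw : IsMotzkin w)
    (hc : (removeStrip w).count Step.U = 0) : numInner w = 0 := by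
  unfold numInner
  rw [Finset.card_eq_zero, Finset.filter_eq_empty_iff]
  intro i _ h
  rw [s.isInner_iff] at h
  exact h.2.2 (s.isInitialStep_of_count_eq_one hw hc h.1)

/-- Here `a ≤ e'`, so every step from `a'` up to `a` lies off the axis; the inner steps of both
paths precede `a'`. -/
theorem numInner_of_height_ne_zero (s : IsLastStrip w a e) {a' e' : ℕ}
    (s' : IsLastStrip (removeStrip w) a' e') (h : height w a ≠ 0) :
    numInner w = numInner (removeStrip w) := by
  have h1 := (s.removeStrip_lt s').1
  have h2 : ¬ e' < a := fun h' => h ((s.removeStrip_down_lt_iff s').1 h')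
  unfold numInner
  rw [length_removeStrip]
  congr 1
  refine Finset.filter_congr fun i _ => ?_
  rw [s.isInner_iff, s'.isInner_iff]
  constructor
  · rintro ⟨h3, h4, h5⟩
    rw [← s.isAxisStep_removeStrip h3] at h4
    rw [← s.isInitialStep_removeStrip h3] at h5
    refine ⟨?_, h4, h5⟩
    by_contra h6
    exact s'.not_isAxisStep (by omega) (by omega) h4
  · rintro ⟨h3, h4, h5⟩
    have h6 : i < a := by omega
    exact ⟨h6, (s.isAxisStep_removeStrip h6).1 h4,
      fun h7 => h5 ((s.isInitialStep_removeStrip h6).2 h7)⟩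

/-- The axis steps strictly between `e'` and `a` are final in the new path but inner in `w`, where
the up step `a` follows them. -/
theorem numInner_of_height_eq_zero (s : IsLastStrip w a e) {a' e' : ℕ}
    (s' : IsLastStrip (removeStrip w) a' e') (h : height w a = 0) :
    numInner w = numInner (removeStrip w) + (a - e' - 1) := by
  have h1 := (s.removeStrip_lt s').1
  have h2 : e' < a := (s.removeStrip_down_lt_iff s').2 h
  have h3 := s.lt
  have h4 := s.lt_length
  have h5 := s'.lt
  unfold numInner
  rw [length_removeStrip, ← Nat.card_Ioo, ← Finset.card_union_of_disjoint]
  · congr 1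
    ext i
    simp only [Finset.mem_filter, Finset.mem_union, Finset.mem_range, Finset.mem_Ioo]
    rw [s.isInner_iff, s'.isInner_iff]
    constructor
    · rintro ⟨h6, h7, h8, h9⟩
      rw [← s.isAxisStep_removeStrip h7] at h8
      rw [← s.isInitialStep_removeStrip h7] at h9
      by_cases h10 : e' < i
      · exact Or.inr ⟨h10, h7⟩
      · refine Or.inl ⟨h6, ?_, h8, h9⟩
        by_contra h11
        exact s'.not_isAxisStep (by omega) (by omega) h8
    · rintro (⟨h6, h7, h8, h9⟩ | ⟨h6, h7⟩)
      · have h10 : i < a := by omega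
        exact ⟨h6, h10, (s.isAxisStep_removeStrip h10).1 h8,
          fun h11 => h9 ((s.isInitialStep_removeStrip h10).2 h11)⟩
      · refine ⟨by omega, h7, (s.isAxisStep_removeStrip h7).1
          (s'.isAxisStep_of_down_lt h6 (by rw [length_removeStrip]; omega)), fun h8 => ?_⟩
        have := s'.lt_of_isInitialStep ((s.isInitialStep_removeStrip h7).2 h8)
        omega
  · rw [Finset.disjoint_left]
    intro i hi hi'
    rw [Finset.mem_filter, s'.isInner_iff] at hi
    rw [Finset.mem_Ioo] at hi'
    omega

end IsLastStrip

/-! ### Canonicity of the strips and induction on their number -/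

theorem strips_eq_nil {w : List Step} (hc : w.count Step.U = 0) : strips w = [] := by
  rw [strips, hc, stripsAux]

theorem IsLastStrip.strips_eq {w : List Step} {a e : ℕ} (s : IsLastStrip w a e) :
    strips w = strips (removeStrip w) ++ [(stripHead w, stripTail w)] := by
  rw [strips, strips, ← s.count_removeStrip, stripsAux]

/-- The second conjunct strengthens the induction: with `e' < e` it shows that the appended head
exceeds all earlier ones. -/
theorem IsMotzkin.isCanonicalList_strips {w : List Step} (hw : IsMotzkin w) :
    IsCanonicalList w.length (strips w) ∧ ∀ p ∈ strips w, p.1 ≤ stripHead w := by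
  induction hk : w.count Step.U generalizing w with
  | zero =>
    rw [strips_eq_nil hk]
    exact ⟨⟨by simp, by simp⟩, by simp⟩
  | succ k ih =>
    obtain ⟨a, e, s⟩ := hw.exists_isLastStrip (by omega)
    have hc := s.count_removeStrip
    have hw' := s.isMotzkin_removeStrip hw
    obtain ⟨ih1, ih2⟩ := ih hw' (by omega)
    rw [IsLastStrip.length_removeStrip] at ih1
    have hlt : ∀ p ∈ strips (removeStrip w), p.1 < stripHead w := by
      intro p hp
      rcases Nat.eq_zero_or_pos ((removeStrip w).count Step.U) with h0 | h0
      · rw [strips_eq_nil h0] at hp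
        cases hp
      · obtain ⟨a', e', s'⟩ := hw'.exists_isLastStrip h0
        have h1 := ih2 p hp
        have h2 := (s.removeStrip_lt s').2
        rw [s'.stripHead_eq] at h1
        rw [s.stripHead_eq]
        omega
    have ht := s.stripTail_eq
    have h0 := s.height_start_nonneg
    rw [s.strips_eq]
    refine ⟨isCanonicalList_append_singleton.2 ⟨ih1, ⟨?_, s.stripTail_le_stripHead, ?_⟩, hlt⟩, ?_⟩
    · simp only
      omega
    · simp only [s.stripHead_eq]
      exact s.lt_length
    · intro p hp
      rcases List.mem_append.1 hp with hp | hp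
      · exact (hlt p hp).le
      · rw [List.mem_singleton.1 hp]

/-- The statistics of horizontal steps on the axis in terms of the strips. -/
theorem IsMotzkin.statistics_of_strips_eq {w : List Step} (hw : IsMotzkin w) {k : ℕ}
    {h t : ℕ → ℕ} (hs : strips w = (List.range k).map fun i => (h (i + 1), t (i + 1))) :
    (1 ≤ k → (t 1 : ℤ) - 1 = numInitial w) ∧
    (1 ≤ k → (w.length : ℤ) - 1 - h k = numFinal w) ∧
    ∑ i ∈ (Finset.Ico 1 k).filter (fun i => h i + 1 < t (i + 1)),
        ((t (i + 1) : ℤ) - h i - 2) = numInner w := by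
  induction k generalizing w with
  | zero =>
    have hc : w.count Step.U = 0 := by
      by_contra hc
      obtain ⟨a, e, s⟩ := hw.exists_isLastStrip (Nat.pos_of_ne_zero hc)
      rw [s.strips_eq] at hs
      simp at hs
    refine ⟨by simp, by simp, ?_⟩
    have : numInner w = 0 := by
      unfold numInner
      rw [Finset.card_eq_zero, Finset.filter_eq_empty_iff]
      intro i hi h
      rw [Finset.mem_range] at hi
      exact h.2.1 fun j hj => hw.isAxisStep_of_no_up hc (by omega)
    simp [this]
  | succ k ih =>
    have hc : 0 < w.count Step.U := by
      by_contra hc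
      rw [strips_eq_nil (by omega)] at hs
      have := congrArg List.length hs
      simp at this
    obtain ⟨a, e, s⟩ := hw.exists_isLastStrip hc
    rw [s.strips_eq, List.range_succ, List.map_append, List.map_singleton] at hs
    obtain ⟨hs', hlast⟩ := List.append_inj' hs (by simp)
    obtain ⟨hh, ht⟩ : stripHead w = h (k + 1) ∧ stripTail w = t (k + 1) := by simpa using hlast
    have hT := s.stripTail_eq
    rw [ht] at hT
    rw [s.stripHead_eq] at hh
    have hw' := s.isMotzkin_removeStrip hw
    obtain ⟨ih1, ih2, ih3⟩ := ih hw' hs'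
    have hlen := s.lt_length
    have hfin : (w.length : ℤ) - 1 - h (k + 1) = numFinal w := by
      rw [s.numFinal_eq, ← hh]
      omega
    rcases Nat.eq_zero_or_pos k with rfl | hk
    · have hc' : (removeStrip w).count Step.U = 0 := by
        by_contra hc'
        obtain ⟨a', e', s'⟩ := hw'.exists_isLastStrip (Nat.pos_of_ne_zero hc')
        rw [s'.strips_eq] at hs'
        simp at hs'
      obtain ⟨hi1, hi2⟩ := s.numInitial_of_count_eq_one hw hc'
      refine ⟨fun _ => ?_, fun _ => hfin, ?_⟩
      · rw [hi1]
        simp only [zero_add] at hT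
        omega
      · simp [s.numInner_of_count_eq_one hw hc']
    · have hc' : 0 < (removeStrip w).count Step.U := by
        by_contra hc'
        rw [strips_eq_nil (by omega)] at hs'
        have := congrArg List.length hs'
        simp at this
        omega
      obtain ⟨a', e', s'⟩ := hw'.exists_isLastStrip hc'
      -- The last pair of the remaining list is the last strip of the new path.
      have hk' : h k = e' := by
        obtain ⟨m, rfl⟩ : ∃ m, k = m + 1 := ⟨k - 1, by omega⟩
        rw [s'.strips_eq, List.range_succ, List.map_append, List.map_singleton] at hs'
        obtain ⟨-, hlast'⟩ := List.append_inj' hs' (by simp)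
        rw [s'.stripHead_eq] at hlast'
        simp only [List.cons.injEq, Prod.mk.injEq] at hlast'
        exact hlast'.1.1.symm
      refine ⟨fun _ => ?_, fun _ => hfin, ?_⟩
      · rw [ih1 hk, s.numInitial_removeStrip s']
      · rw [Finset.sum_filter] at ih3 ⊢
        rw [Finset.sum_Ico_succ_top hk, ih3, hk']
        -- The top term is `a + height w a - e' - 1`; it passes the filter exactly when `a` starts
        -- on the axis.
        by_cases h0 : height w a = 0
        · have h1 := (s.removeStrip_down_lt_iff s').2 h0
          rw [s.numInner_of_height_eq_zero s' h0, if_pos (by omega)]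
          omega
        · have h1 := s.add_height_le_removeStrip_down s' h0
          rw [s.numInner_of_height_ne_zero s' h0, if_neg (by omega)]
          omega

end Motzkin

theorem mainTheorem5 (n : ℕ) (P : MotzkinPath n) (k : ℕ) (h t : ℕ → ℕ)
    (hd : Motzkin.IsCanonicalDecomposition n P.phi k h t) :
    (1 ≤ k → (t 1 : ℤ) - 1 = (Motzkin.numInitial P.steps : ℤ)) ∧
    (1 ≤ k → (n : ℤ) - 1 - (h k : ℤ) = (Motzkin.numFinal P.steps : ℤ)) ∧
    (∑ i ∈ (Finset.Ico 1 k).filter (fun i => h i + 1 < t (i + 1)),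
        ((t (i + 1) : ℤ) - (h i : ℤ) - 2)) = (Motzkin.numInner P.steps : ℤ) := by
  have hlen := P.length_eq
  have hw : Motzkin.IsMotzkin P.steps :=
    ⟨fun i hi => P.height_nonneg i (by omega), by rw [hlen]; exact P.height_end⟩
  have hs := hw.isCanonicalList_strips.1
  rw [hlen] at hs
  -- Uniqueness identifies the given heads and tails with the strips.
  have := hw.statistics_of_strips_eq (hs.eq_of_permOfPairs_eq hd.isCanonicalList hd.eq_prod)
  rwa [hlen] at this
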